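/- Let $n \ge 1$ be an integer and let $K$ be a field with $|K| \ge n+1$. Then the maximal dimension of a (nonempty) affine subspace of the space of $n\times n$ matrices over $K$, all of whose elements are nilpotent of rank exactly $n-1$, is $$\frac{(n-1)(n-2)}{2}.$$ Moreover, for a nilpotent $n\times n$ matrix $A$ over $K$, having rank $n-1$ is equivalent to having nilindex $n$, where the nilindex is the least $k$ such that $A^k=0$. The maximum is attained by the affine subspace $J+N$, where $J$ is the $n\times n$ matrix with $J_{i,j}=1$ if $j=i+1$ and $J_{i,j}=0$ otherwise, and $N$ is the linear space of all strictly upper triangular $n\times n$ matrices over $K$ that vanish on the superdiagonal (that is, $B_{i,j}=0$ whenever $j\le i+1$). -/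

import Mathlib

/-- The `n × n` matrix with ones on the superdiagonal and zeros elsewhere. -/
def superdiagonalShift (n : ℕ) (K : Type*) [Field K] : Matrix (Fin n) (Fin n) K :=
  Matrix.of fun i j => if (j : ℕ) = (i : ℕ) + 1 then 1 else 0

/-- The linear space of strictly upper triangular `n × n` matrices that also vanish on the
superdiagonal: every entry `(i, j)` with `j ≤ i + 1` is zero. -/
def strictUpperZeroSuperdiagonal (n : ℕ) (K : Type*) [Field K] :
    Submodule K (Matrix (Fin n) (Fin n) K) where
  carrier := {B | ∀ i j : Fin n, (j : ℕ) ≤ (i : ℕ) + 1 → B i j = 0}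
  zero_mem' := fun _ _ _ => rfl
  add_mem' := fun {A B} hA hB i j h => by
    rw [Matrix.add_apply, hA i j h, hB i j h, add_zero]
  smul_mem' := fun c A hA i j h => by
    rw [Matrix.smul_apply, hA i j h, smul_zero]

/-- A (nonempty) affine subspace of `n × n` matrices all of whose elements are nilpotent of rank
exactly `n - 1`. -/
def IsNilpotentCorankOneAffine {n : ℕ} {K : Type*} [Field K]
    (S : AffineSubspace K (Matrix (Fin n) (Fin n) K)) : Prop :=
  (S : Set (Matrix (Fin n) (Fin n) K)).Nonempty ∧
    ∀ A ∈ S, IsNilpotent A ∧ A.rank = n - 1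

open Module

/-! The upper bound goes by induction on the dimension of `E`, for an affine space `P + V` of
nilpotents of maximal nilindex. Let `e` span `ker P`, let `U = V e`, and let `V'` be the part of `V`
that kills `e`. Then `dim V = dim U + dim V'`, and `V'` acts on `E / Ke`, where the induction
hypothesis bounds its image. The kernel of this action consists of rank-one maps `φ ⊗ e`.

The trade-off is `exists_large_subspace_annihilated`: every such `φ` kills a subspace of dimension
at least `dim U + 2`. Hence the kernel has dimension at most `dim E - dim U - 2`, `dim U` cancels,
and passing from dimension `n + 1` to `n + 2` costs at most `n`. The subspace is spanned by the
orbits of `e` under all elements of `P + V`; it is killed by `apply_pow_eq_zero_of_rank_one_pencil`,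
a resolvent argument.

The size of `K` enters only through polynomials in a pencil parameter that vanish at all nonzero
scalars. -/

theorem eq_zero_of_forall_ne_zero_eval {K : Type*} [Field K] {n : ℕ}
    (hK : ((n + 1 : ℕ) : Cardinal) ≤ Cardinal.mk K) {p : Polynomial K} (hp : p.natDegree < n)
    (h : ∀ t ≠ 0, p.eval t = 0) : p = 0 := by
  classical
  obtain ⟨s, hs⟩ : ∃ s : Finset K, n + 1 ≤ s.card := by
    rcases finite_or_infinite K with hf | hf
    · have := Fintype.ofFinite K
      refine ⟨Finset.univ, ?_⟩
      rw [Cardinal.mk_fintype] at hK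
      exact_mod_cast hK
    · obtain ⟨s, hs⟩ := Infinite.exists_subset_card_eq K (n + 1)
      exact ⟨s, hs.ge⟩
  refine Polynomial.eq_zero_of_natDegree_lt_card_of_eval_eq_zero' p (s.erase 0)
    (fun t ht => h t (Finset.ne_of_mem_erase ht)) ?_
  have := Finset.pred_card_le_card_erase (s := s) (a := 0)
  omega

/-! ### Nilpotent endomorphisms, nilindex and pencils. -/

section Nilpotent

variable {K E : Type*} [Field K] [AddCommGroup E] [Module K E]

theorem eigenvalue_eq_zero_of_isNilpotent {N : End K E} (hN : IsNilpotent N) {v : E} {c : K}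
    (hv : v ≠ 0) (h : N v = c • v) : c = 0 := by
  obtain ⟨m, hm⟩ := hN
  have hp : ∀ k, (N ^ k) v = c ^ k • v := by
    intro k
    induction k with
    | zero => simp
    | succ k ih => rw [pow_succ, Module.End.mul_apply, h, map_smul, ih, smul_smul, pow_succ']
  have h1 := hp m
  rw [hm, LinearMap.zero_apply, eq_comm, smul_eq_zero] at h1
  exact eq_zero_of_pow_eq_zero (h1.resolve_right hv)

theorem exists_polynomial_eval_eq_pencil_pow (A B : End K E) (g : Dual K E) (m : ℕ) (w : E) :
    ∃ p : Polynomial K, p.natDegree ≤ m ∧ ∀ t, p.eval t = g (((A + t • B) ^ m) w) := by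
  induction m generalizing w with
  | zero => exact ⟨Polynomial.C (g w), by simp, by simp⟩
  | succ m ih =>
    obtain ⟨p, hp, hp'⟩ := ih (A w)
    obtain ⟨q, hq, hq'⟩ := ih (B w)
    refine ⟨p + Polynomial.X * q, ?_, fun t => ?_⟩
    · refine Polynomial.natDegree_add_le_of_degree_le (by omega) ?_
      refine Polynomial.natDegree_mul_le.trans ?_
      have := Polynomial.natDegree_X_le (R := K)
      omega
    · rw [pow_succ, Module.End.mul_apply]
      simp [hp', hq']

variable [FiniteDimensional K E]

theorem pow_finrank_eq_zero_of_isNilpotent {N : End K E} (hN : IsNilpotent N) :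
    N ^ finrank K E = 0 := by
  have h2 := hN.charpoly_eq_X_pow_finrank
  have := LinearMap.aeval_self_charpoly N
  rw [h2] at this
  simpa using this

/-- `N ^ k` sends `ker (N ^ (k + 1))` into `ker N`, so each further power adds at most one
dimension. -/
theorem finrank_ker_pow_le {N : End K E} (h : finrank K (LinearMap.ker N) ≤ 1) (k : ℕ) :
    finrank K (LinearMap.ker (N ^ k)) ≤ k := by
  induction k with
  | zero => simp [Module.End.one_eq_id, LinearMap.ker_id]
  | succ k ih =>
    have h1 := LinearMap.finrank_range_add_finrank_ker
      ((N ^ k).domRestrict (LinearMap.ker (N ^ (k + 1))))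
    have h2 : finrank K (LinearMap.range
        ((N ^ k).domRestrict (LinearMap.ker (N ^ (k + 1))))) ≤ finrank K (LinearMap.ker N) := by
      apply Submodule.finrank_mono
      rintro _ ⟨⟨x, hx⟩, rfl⟩
      rw [LinearMap.mem_ker, pow_succ'] at hx
      exact hx
    have h3 : finrank K (LinearMap.ker ((N ^ k).domRestrict (LinearMap.ker (N ^ (k + 1))))) ≤
        finrank K (LinearMap.ker (N ^ k)) := by
      refine LinearMap.finrank_le_finrank_of_injective (f := LinearMap.codRestrict
        (LinearMap.ker (N ^ k)) ((Submodule.subtype _).comp (Submodule.subtype _))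
        (fun x => x.2)) ?_
      intro x y hxy
      have := congrArg Subtype.val hxy
      exact Subtype.ext (Subtype.ext this)
    omega

/-- The ranges of the powers decrease strictly until they vanish: one equality would make the chain
stationary, and nilpotency would then make it zero. -/
theorem finrank_range_pow_add_le {N : End K E} (hN : IsNilpotent N) {k j : ℕ}
    (hk : N ^ (k + j) ≠ 0) : j + 1 ≤ finrank K (LinearMap.range (N ^ k)) := by
  induction j generalizing k with
  | zero =>
    rw [Nat.succ_le_iff, Nat.pos_iff_ne_zero]
    intro h
    rw [Submodule.finrank_eq_zero, LinearMap.range_eq_bot] at h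
    exact hk h
  | succ j ih =>
    have h1 := ih (k := k + 1) (by rwa [show k + 1 + j = k + (j + 1) by ring])
    have hle : LinearMap.range (N ^ (k + 1)) ≤ LinearMap.range (N ^ k) := by
      rw [pow_succ]
      exact LinearMap.range_comp_le_range _ _
    have hlt : LinearMap.range (N ^ (k + 1)) < LinearMap.range (N ^ k) := by
      refine lt_of_le_of_ne hle fun heq => ?_
      have hst : ∀ m, LinearMap.range (N ^ (k + m)) = LinearMap.range (N ^ k) := by
        intro m
        induction m with
        | zero => rfl
        | succ m ihm =>
          have e1 : LinearMap.range (N ^ (k + (m + 1))) =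
              (LinearMap.range (N ^ (k + m))).map N := by
            rw [← add_assoc, pow_succ', Module.End.mul_eq_comp, LinearMap.range_comp]
          have e2 : LinearMap.range (N ^ (k + 1)) = (LinearMap.range (N ^ k)).map N := by
            rw [pow_succ', Module.End.mul_eq_comp, LinearMap.range_comp]
          rw [e1, ihm, ← e2, heq]
      obtain ⟨m, hm⟩ := hN
      have h0 := hst m
      rw [pow_add, hm, mul_zero, LinearMap.range_zero] at h0
      have : N ^ k = 0 := LinearMap.range_eq_bot.mp h0.symm
      exact hk (by rw [pow_add, this, zero_mul])
    have := Submodule.finrank_lt_finrank_of_lt hlt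
    omega

/-- On an `n + 1`-dimensional space, a nilpotent endomorphism has nilindex `n + 1` exactly when its
kernel is at most a line. -/
theorem finrank_ker_le_one_iff_pow_ne_zero {n : ℕ} (hE : finrank K E = n + 1) {N : End K E}
    (hN : IsNilpotent N) : finrank K (LinearMap.ker N) ≤ 1 ↔ N ^ n ≠ 0 := by
  constructor
  · intro h h0
    have h1 := finrank_ker_pow_le h n
    rw [h0, LinearMap.ker_zero, finrank_top] at h1
    omega
  · intro h
    have h1 := LinearMap.finrank_range_add_finrank_ker N
    rcases n with _ | n
    · omega
    · have h2 := finrank_range_pow_add_le (k := 1) (j := n) hN (by rwa [add_comm])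
      rw [pow_one] at h2
      omega

/-- If a pencil `A + t R` with `R = φ ⊗ e` of rank one consists of nilpotents, then `φ` kills the
cyclic subspace generated by `e`. -/
theorem apply_pow_eq_zero_of_rank_one_pencil {n : ℕ} (hE : finrank K E = n)
    (hK : ((n + 1 : ℕ) : Cardinal) ≤ Cardinal.mk K) {A R : End K E} {φ : Dual K E} {e : E}
    (hR : ∀ x, R x = φ x • e) (hA : ∀ t : K, IsNilpotent (A + t • R)) (k : ℕ) :
    φ ((A ^ k) e) = 0 := by
  have hAn : A ^ n = 0 := by
    rw [← hE]
    exact pow_finrank_eq_zero_of_isNilpotent (by simpa using hA 0)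
  have hs : ∀ s : K, s ≠ 0 → ∑ i ∈ Finset.range n, s ^ i * φ ((A ^ i) e) = 0 := by
    intro s hs
    -- Since `A ^ n = 0`, this is `(1 - s A)⁻¹ e`.
    set v : E := ∑ i ∈ Finset.range n, s ^ i • (A ^ i) e with hv
    have hφ : φ v = ∑ i ∈ Finset.range n, s ^ i * φ ((A ^ i) e) := by
      simp [hv, map_sum]
    rw [← hφ]
    by_contra hc
    have hAv : s • A v = v - e := by
      have h1 := Finset.sum_range_succ' (fun i => s ^ i • (A ^ i) e) n
      rw [Finset.sum_range_succ, hAn] at h1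
      simp only [LinearMap.zero_apply, smul_zero, add_zero, pow_zero, one_smul,
        Module.End.one_apply, ← hv] at h1
      rw [← sub_eq_iff_eq_add] at h1
      rw [h1, hv, map_sum, Finset.smul_sum]
      refine Finset.sum_congr rfl fun i _ => ?_
      rw [map_smul, smul_smul, ← pow_succ', pow_succ' A, Module.End.mul_apply]
    have hAv' : A v = s⁻¹ • (v - e) := by rw [← hAv, inv_smul_smul₀ hs]
    -- The parameter is chosen so that the rank-one term restores the missing `s⁻¹ • e`, making `v`
    -- an eigenvector for `s⁻¹ ≠ 0`.
    refine inv_ne_zero hs (eigenvalue_eq_zero_of_isNilpotent (hA (s⁻¹ * (φ v)⁻¹)) (v := v) ?_ ?_)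
    · rintro h0
      exact hc (by rw [h0, map_zero])
    · rw [LinearMap.add_apply, LinearMap.smul_apply, hAv', hR, smul_smul, mul_assoc,
        inv_mul_cancel₀ hc, mul_one, smul_sub, sub_add_cancel]
  by_cases hkn : n ≤ k
  · rw [pow_eq_zero_of_le hkn hAn]
    simp
  push Not at hkn
  set p : Polynomial K :=
    ∑ i ∈ Finset.range n, Polynomial.monomial i (φ ((A ^ i) e)) with hp
  have hp0 : p = 0 := by
    refine eq_zero_of_forall_ne_zero_eval hK ?_ ?_
    · refine lt_of_le_of_lt (Polynomial.natDegree_sum_le_of_forall_le (n := n - 1) _ _ ?_)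
        (by omega)
      intro i hi
      refine (Polynomial.natDegree_monomial_le _).trans ?_
      have := Finset.mem_range.mp hi
      omega
    · intro t ht
      rw [hp, Polynomial.eval_finsetSum, ← hs t ht]
      exact Finset.sum_congr rfl fun i _ => by rw [Polynomial.eval_monomial, mul_comm]
  have hc := congrArg (fun q => Polynomial.coeff q k) hp0
  simpa [hp, Polynomial.finsetSum_coeff, Polynomial.coeff_monomial, hkn] using hc

/-- Each coordinate is a polynomial in `t` of degree at most `m`, with at least `n > m` nonzero
roots, so it also vanishes at `t = 0`. -/
theorem pow_apply_eq_zero_of_pencil {n m : ℕ} (hK : ((n + 1 : ℕ) : Cardinal) ≤ Cardinal.mk K)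
    (hm : m < n) {A B : End K E} {w : E} (h : ∀ t : K, t ≠ 0 → ((A + t • B) ^ m) w = 0) :
    (A ^ m) w = 0 := by
  rw [← Module.forall_dual_apply_eq_zero_iff K]
  intro g
  obtain ⟨p, hp, hp'⟩ := exists_polynomial_eval_eq_pencil_pow A B g m w
  have hp0 : p = 0 := eq_zero_of_forall_ne_zero_eval hK (by omega) fun t ht => by
    rw [hp', h t ht, map_zero]
  have := hp' 0
  rw [hp0] at this
  simpa using this.symm

/-- A nilpotent endomorphism whose orbit of `v` stays in a subspace of dimension `r` satisfies
`N ^ r v = 0`. -/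
theorem pow_finrank_apply_eq_zero {N : End K E} (hN : IsNilpotent N) {v : E} (Y : Submodule K E)
    (h : ∀ k, (N ^ k) v ∈ Y) : (N ^ finrank K Y) v = 0 := by
  set Z : Submodule K E := Submodule.span K (Set.range fun k => (N ^ k) v) with hZ
  have hZY : Z ≤ Y := Submodule.span_le.mpr (by rintro _ ⟨k, rfl⟩; exact h k)
  have hmaps : ∀ x ∈ Z, N x ∈ Z := by
    intro x hx
    have : Z ≤ Z.comap N := by
      rw [hZ, Submodule.span_le]
      rintro _ ⟨k, rfl⟩
      refine Submodule.subset_span ⟨k + 1, ?_⟩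
      simp only [pow_succ', Module.End.mul_apply]
    exact this hx
  have hr : ∀ k (x : Z), (((N.restrict hmaps) ^ k) x : E) = (N ^ k) (x : E) := by
    intro k x
    rw [Module.End.pow_restrict k hmaps
      (fun x hx => Module.End.pow_apply_mem_of_forall_mem k hmaps x hx)]
    rfl
  have hnil : IsNilpotent (N.restrict hmaps) := by
    obtain ⟨m, hm⟩ := hN
    refine ⟨m, LinearMap.ext fun x => Subtype.ext ?_⟩
    rw [hr, hm]
    rfl
  have h0 := pow_finrank_eq_zero_of_isNilpotent hnil
  have hv : v ∈ Z := Submodule.subset_span ⟨0, by simp⟩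
  have h1 : (N ^ finrank K Z) v = 0 := by
    rw [← hr _ ⟨v, hv⟩, h0]
    rfl
  obtain ⟨c, hc⟩ := Nat.exists_eq_add_of_le' (Submodule.finrank_mono hZY)
  rw [hc, pow_add, Module.End.mul_apply, h1, map_zero]

end Nilpotent

/-! ### The trade-off between `V e` and the rank-one maps onto `Ke`. -/

section Main

variable {K E : Type*} [Field K] [AddCommGroup E] [Module K E] [FiniteDimensional K E]

/-- In an affine space `P + V` of endomorphisms of nilindex `n + 2`, let `e` span the kernel of `P`.
The functionals `φ` such that `V` contains `φ ⊗ e` all vanish on a subspace of dimension at least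
`dim (V e) + 2`. -/
theorem exists_large_subspace_annihilated {n : ℕ} (hE : finrank K E = n + 2)
    (hK : ((n + 2 + 1 : ℕ) : Cardinal) ≤ Cardinal.mk K) {P : End K E} {V : Submodule K (End K E)}
    (hnil : ∀ B ∈ V, IsNilpotent (P + B)) (hne : ∀ B ∈ V, (P + B) ^ (n + 1) ≠ 0)
    {e e' : E} (he : e ≠ 0) (hPe : P e = 0) (hPe' : P e' = e) :
    ∃ Y : Submodule K E, finrank K (V.map (LinearMap.applyₗ e)) + 2 ≤ finrank K Y ∧
      ∀ R ∈ V, ∀ φ : Dual K E, (∀ x, R x = φ x • e) → ∀ y ∈ Y, φ y = 0 := by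
  have hPnil : IsNilpotent P := by simpa using hnil 0 V.zero_mem
  have hkill : ∀ A ∈ V, ∀ R ∈ V, ∀ φ : Dual K E, (∀ x, R x = φ x • e) →
      ∀ k, φ (((P + A) ^ k) e) = 0 := by
    intro A hA R hR φ hφ k
    refine apply_pow_eq_zero_of_rank_one_pencil hE hK hφ (fun t => ?_) k
    rw [add_assoc]
    exact hnil _ (V.add_mem hA (V.smul_mem t hR))
  set U := V.map (LinearMap.applyₗ e) with hU
  -- When `U = 0` every orbit of `e` stays in `Ke`, so the second dimension has to come from `e'`:
  -- if `φ e' ≠ 0`, a multiple of `R` cancels `P e'` and enlarges the kernel to a plane.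
  by_cases hU0 : U = ⊥
  · have hli : LinearIndependent K ![e, e'] := by
      rw [LinearIndependent.pair_iff]
      intro a b hab
      have hb : b = 0 := by
        have := congrArg P hab
        simpa [hPe, hPe', he] using this
      refine ⟨?_, hb⟩
      simpa [hb, he] using hab
    refine ⟨Submodule.span K (Set.range ![e, e']), ?_, ?_⟩
    · rw [finrank_span_eq_card hli, hU0, finrank_bot]
      simp
    · intro R hR φ hφ
      have h0 : φ e = 0 := by simpa using hkill 0 V.zero_mem R hR φ hφ 0
      have h1 : φ e' = 0 := by
        by_contra hc
        have hmem : (-(φ e')⁻¹) • R ∈ V := V.smul_mem _ hR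
        have hker := (finrank_ker_le_one_iff_pow_ne_zero hE (hnil _ hmem)).mpr (hne _ hmem)
        have hle : Submodule.span K (Set.range ![e, e']) ≤
            LinearMap.ker (P + (-(φ e')⁻¹) • R) := by
          rw [Submodule.span_le]
          rintro _ ⟨i, rfl⟩
          fin_cases i
          · simp [hPe, hφ, h0]
          · simp [hPe', hφ, smul_smul, hc]
        have := Submodule.finrank_mono hle
        rw [finrank_span_eq_card hli] at this
        simp at this
        omega
      intro y hy
      have hle : Submodule.span K (Set.range ![e, e']) ≤ LinearMap.ker φ := by
        rw [Submodule.span_le]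
        rintro _ ⟨i, rfl⟩
        fin_cases i
        · simpa using h0
        · simpa using h1
      exact hle hy
  · set Y : Submodule K E :=
      Submodule.span K {y | ∃ A ∈ V, ∃ k, y = ((P + A) ^ k) e} with hY
    have hYmem : ∀ A ∈ V, ∀ k, ((P + A) ^ k) e ∈ Y := fun A hA k =>
      Submodule.subset_span ⟨A, hA, k, rfl⟩
    refine ⟨Y, ?_, fun R hR φ hφ y hy => ?_⟩
    · have heY : e ∈ Y := by simpa using hYmem 0 V.zero_mem 0
      have hUY : U ≤ Y := by
        rintro _ ⟨A, hA, rfl⟩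
        have := hYmem A hA 1
        simpa [hPe] using this
      have hdisj : Disjoint (K ∙ e) U := by
        rw [disjoint_comm, Submodule.disjoint_span_singleton' he]
        rintro ⟨A, hA, hAe⟩
        refine one_ne_zero (eigenvalue_eq_zero_of_isNilpotent (hnil A hA) he (c := (1 : K)) ?_)
        have hAe' : A e = e := hAe
        rw [LinearMap.add_apply, hPe, hAe', zero_add, one_smul]
      have hdim : finrank K (K ∙ e ⊔ U : Submodule K E) = finrank K U + 1 := by
        have := Submodule.finrank_sup_add_finrank_inf_eq (K ∙ e) U
        rw [hdisj.eq_bot, finrank_bot, finrank_span_singleton he] at this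
        omega
      have hle : K ∙ e ⊔ U ≤ Y :=
        sup_le ((Submodule.span_singleton_le_iff_mem _ _).mpr heY) hUY
      -- `Ke ⊕ U` already gives `dim U + 1`. If it were all of `Y`, then `Y` would lie in `ker (P ^
      -- m)` with `m = dim U`, a space of dimension at most `m`.
      by_contra hlt
      push Not at hlt
      have heq : K ∙ e ⊔ U = Y := Submodule.eq_of_le_of_finrank_le hle (by omega)
      rw [heq] at hdim
      have hUpos : finrank K U ≠ 0 := fun h => hU0 (Submodule.finrank_eq_zero.mp h)
      set m := finrank K U with hm
      have hmn : m < n + 2 := by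
        have := Submodule.finrank_le Y
        omega
      have hpow : ∀ A ∈ V, (P ^ m) (A e) = 0 := by
        intro A hA
        -- The orbit of `e` under `P + t A` stays in `Y`, so its power `m + 1` kills `e`; one factor
        -- sends `e` to `t • A e`, and `t` is cancelled.
        refine pow_apply_eq_zero_of_pencil hK hmn (B := A) fun t ht => ?_
        have htA := V.smul_mem t hA
        have h0 := pow_finrank_apply_eq_zero (hnil _ htA) Y (hYmem _ htA)
        rw [hdim, pow_succ, Module.End.mul_apply] at h0
        simpa [hPe, ht] using h0
      have hYker : Y ≤ LinearMap.ker (P ^ m) := by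
        rw [← heq]
        refine sup_le ((Submodule.span_singleton_le_iff_mem _ _).mpr ?_) ?_
        · obtain ⟨m', hm'⟩ := Nat.exists_eq_succ_of_ne_zero hUpos
          rw [LinearMap.mem_ker, hm', pow_succ, Module.End.mul_apply, hPe, map_zero]
        · rintro _ ⟨A, hA, rfl⟩
          exact hpow A hA
      have h1 := Submodule.finrank_mono hYker
      have h2 := finrank_ker_pow_le ((finrank_ker_le_one_iff_pow_ne_zero hE hPnil).mpr
        (by simpa using hne 0 V.zero_mem)) m
      omega
    · have : Y ≤ LinearMap.ker φ := by
        rw [hY, Submodule.span_le]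
        rintro _ ⟨A, hA, k, rfl⟩
        exact hkill A hA R hR φ hφ k
      exact this hy

end Main

/-! ### The upper bound, by induction on the dimension. -/

theorem finrank_le_of_affine_nilindex {K : Type*} [Field K] (n : ℕ)
    (hK : ((n + 1 + 1 : ℕ) : Cardinal) ≤ Cardinal.mk K) {E : Type*} [AddCommGroup E] [Module K E]
    [FiniteDimensional K E] (hE : finrank K E = n + 1) (P : End K E) (V : Submodule K (End K E))
    (hnil : ∀ B ∈ V, IsNilpotent (P + B)) (hne : ∀ B ∈ V, (P + B) ^ n ≠ 0) :
    finrank K V ≤ n * (n - 1) / 2 := by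
  induction n generalizing E with
  | zero =>
    have hz : ∀ N : End K E, IsNilpotent N → N = 0 := fun N hN => by
      have := pow_finrank_eq_zero_of_isNilpotent hN
      rwa [hE, pow_one] at this
    have : V = ⊥ := by
      rw [Submodule.eq_bot_iff]
      intro B hB
      have h1 := hz _ (hnil B hB)
      have h2 := hz _ (hnil 0 V.zero_mem)
      rw [add_zero] at h2
      rwa [h2, zero_add] at h1
    simp [this]
  | succ n ih =>
    have hP := hne 0 V.zero_mem
    have hPz := pow_finrank_eq_zero_of_isNilpotent (hnil 0 V.zero_mem)
    rw [add_zero] at hP hPz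
    rw [hE] at hPz
    obtain ⟨x, hx⟩ : ∃ x, (P ^ (n + 1)) x ≠ 0 := by
      by_contra! h
      exact hP (LinearMap.ext h)
    set e := (P ^ (n + 1)) x with he
    have hPe : P e = 0 := by
      rw [he, ← Module.End.mul_apply, ← pow_succ', hPz, LinearMap.zero_apply]
    have hPe' : P ((P ^ n) x) = e := by
      rw [he, ← Module.End.mul_apply, ← pow_succ']
    obtain ⟨Y, hYdim, hY⟩ := exists_large_subspace_annihilated hE hK hnil hne hx hPe hPe'
    set ev : V →ₗ[K] E := (LinearMap.applyₗ e).domRestrict V with hev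
    have hrange : LinearMap.range ev = V.map (LinearMap.applyₗ e) := by
      rw [hev, LinearMap.domRestrict, LinearMap.range_comp, Submodule.range_subtype]
    set V' : Submodule K V := LinearMap.ker ev with hV'
    have hV'e : ∀ B : V', (B : End K E) e = 0 := fun B => B.2
    have hd1 : finrank K (V.map (LinearMap.applyₗ e)) + finrank K V' = finrank K V := by
      rw [← hrange]
      exact LinearMap.finrank_range_add_finrank_ker ev
    set L : Submodule K E := K ∙ e with hL
    have hstab : ∀ N : End K E, N e = 0 → L ≤ L.comap N := fun N hN => by
      rw [hL, Submodule.span_singleton_le_iff_mem, Submodule.mem_comap, hN]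
      exact Submodule.zero_mem _
    set q : V' →ₗ[K] End K (E ⧸ L) :=
      { toFun := fun B => L.mapQ L (B : End K E) (hstab _ (hV'e B))
        map_add' := fun B C => by
          refine LinearMap.ext fun y => ?_
          obtain ⟨y, rfl⟩ := Submodule.Quotient.mk_surjective _ y
          rfl
        map_smul' := fun c B => by
          refine LinearMap.ext fun y => ?_
          obtain ⟨y, rfl⟩ := Submodule.Quotient.mk_surjective _ y
          rfl } with hq
    have hd2 := LinearMap.finrank_range_add_finrank_ker (K := K) (V := V')
      (V₂ := End K (E ⧸ L)) q
    have hEL : finrank K (E ⧸ L) = n + 1 := by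
      have := L.finrank_quotient_add_finrank
      have hL1 : finrank K L = 1 := finrank_span_singleton hx
      omega
    have hpowQ : ∀ (B : V') (k : ℕ) (y : E),
        ((L.mapQ L P (hstab P hPe) + q B) ^ k) (Submodule.Quotient.mk y) =
          Submodule.Quotient.mk (((P + (B : End K E)) ^ k) y) := by
      intro B k
      induction k with
      | zero => intro y; rfl
      | succ k ihk =>
        intro y
        rw [pow_succ, pow_succ, Module.End.mul_apply, Module.End.mul_apply, ← ihk]
        rfl
    have hd3 : finrank K (LinearMap.range q) ≤ n * (n - 1) / 2 := by
      refine ih (le_trans ?_ hK) hEL (L.mapQ L P (hstab P hPe)) (LinearMap.range q) ?_ ?_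
      · exact_mod_cast Nat.le_succ _
      · rintro _ ⟨B, rfl⟩
        obtain ⟨m, hm⟩ := hnil _ B.1.2
        refine ⟨m, LinearMap.ext fun y => ?_⟩
        obtain ⟨y, rfl⟩ := Submodule.Quotient.mk_surjective _ y
        rw [hpowQ, hm]
        rfl
      · rintro _ ⟨B, rfl⟩ h0
        -- If the `n`-th power vanished on `E / Ke`, then `(P + B) ^ n` would have range in `Ke`,
        -- which `P + B` kills.
        refine hne _ B.1.2 (LinearMap.ext fun y => ?_)
        have hy := hpowQ B n y
        rw [h0, LinearMap.zero_apply, eq_comm, Submodule.Quotient.mk_eq_zero, hL,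
          Submodule.mem_span_singleton] at hy
        obtain ⟨c, hc⟩ := hy
        rw [pow_succ', Module.End.mul_apply, ← hc, map_smul, LinearMap.add_apply, hPe, hV'e,
          add_zero, smul_zero, LinearMap.zero_apply]
    obtain ⟨g, hg⟩ : ∃ g : Dual K E, g e = 1 :=
      Module.Projective.exists_dual_eq_one K hx
    have hker : ∀ B : LinearMap.ker q, ∀ y, ((B : V') : End K E) y =
        g (((B : V') : End K E) y) • e := by
      intro B y
      have h0 : q B = 0 := B.2
      have h1 : Submodule.Quotient.mk (p := L) (((B : V') : End K E) y) = 0 := by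
        have := LinearMap.congr_fun h0 (Submodule.Quotient.mk y)
        exact this
      rw [Submodule.Quotient.mk_eq_zero] at h1
      obtain ⟨c, hc⟩ := Submodule.mem_span_singleton.mp h1
      rw [← hc, map_smul, hg, smul_eq_mul, mul_one]
    -- `B = φ ⊗ e` is recovered from `φ = g ∘ B`, which lies in the annihilator of `Y`.
    have hd4 : finrank K (LinearMap.ker q) ≤ finrank K Y.dualAnnihilator := by
      refine LinearMap.finrank_le_finrank_of_injective (f := LinearMap.codRestrict
        Y.dualAnnihilator ((LinearMap.llcomp K E E K g).comp
          (V.subtype.comp (V'.subtype.comp (LinearMap.ker q).subtype))) (fun B => ?_)) ?_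
      · rw [Submodule.mem_dualAnnihilator]
        exact hY _ B.1.1.2 _ (hker B)
      · intro B C hBC
        have h1 : ∀ y, g (((B : V') : End K E) y) = g (((C : V') : End K E) y) :=
          LinearMap.congr_fun (congrArg Subtype.val hBC)
        refine Subtype.ext (Subtype.ext (Subtype.ext (LinearMap.ext fun y => ?_)))
        rw [hker B, hker C, h1]
    have hd5 := Subspace.finrank_add_finrank_dualAnnihilator_eq Y
    have harith : (n + 1) * (n + 1 - 1) / 2 = n * (n - 1) / 2 + n := by
      have := Finset.sum_range_succ (fun i => i) n
      rwa [Finset.sum_range_id, Finset.sum_range_id] at this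
    rw [harith]
    omega

/-! ### Translation to matrices: rank and nilindex. -/

theorem isNilpotent_toLin'_iff {n : ℕ} {K : Type*} [Field K] (A : Matrix (Fin n) (Fin n) K) :
    IsNilpotent (Matrix.toLinAlgEquiv' A) ↔ IsNilpotent A :=
  IsNilpotent.map_iff (Matrix.toLinAlgEquiv' (R := K) (n := Fin n)).injective

/-- A nilpotent `n + 1 × n + 1` matrix has rank `n` exactly when its `n`-th power is nonzero. -/
theorem rank_eq_iff_pow_ne_zero {n : ℕ} {K : Type*} [Field K]
    {A : Matrix (Fin (n + 1)) (Fin (n + 1)) K} (hA : IsNilpotent A) :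
    A.rank = n ↔ A ^ n ≠ 0 := by
  have hE : finrank K (Fin (n + 1) → K) = n + 1 := by simp
  have hN := (isNilpotent_toLin'_iff A).mpr hA
  have h1 := finrank_ker_le_one_iff_pow_ne_zero hE hN
  rw [← map_pow, Ne, EmbeddingLike.map_eq_zero_iff] at h1
  rw [← Ne] at h1
  rw [← h1]
  have h2 := LinearMap.finrank_range_add_finrank_ker (Matrix.toLinAlgEquiv' A)
  have h3 : A.rank = finrank K (LinearMap.range (Matrix.toLinAlgEquiv' A)) := rfl
  have h4 : finrank K (LinearMap.ker (Matrix.toLinAlgEquiv' A)) ≠ 0 := by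
    intro h0
    rw [Submodule.finrank_eq_zero, LinearMap.ker_eq_bot] at h0
    obtain ⟨m, hm⟩ := hN
    have hinj := Module.End.iterate_injective h0 m
    rw [hm] at hinj
    have := hinj (a₁ := fun _ => 0) (a₂ := fun _ => 1) rfl
    exact zero_ne_one (congrFun this 0)
  omega

theorem pow_eq_zero_of_isNilpotent_matrix {n : ℕ} {K : Type*} [Field K]
    {A : Matrix (Fin n) (Fin n) K} (hA : IsNilpotent A) : A ^ n = 0 := by
  have h := pow_finrank_eq_zero_of_isNilpotent ((isNilpotent_toLin'_iff A).mpr hA)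
  rwa [← map_pow, EmbeddingLike.map_eq_zero_iff, finrank_fin_fun] at h

theorem rank_eq_iff_nilpotencyClass_eq {n : ℕ} {K : Type*} [Field K]
    {A : Matrix (Fin (n + 1)) (Fin (n + 1)) K} (hA : IsNilpotent A) :
    A.rank = n ↔ nilpotencyClass A = n + 1 := by
  rw [rank_eq_iff_pow_ne_zero hA, nilpotencyClass_eq_succ_iff]
  exact ⟨fun h => ⟨pow_eq_zero_of_isNilpotent_matrix hA, h⟩, fun h => h.2⟩

theorem finrank_direction_le {n : ℕ} {K : Type*} [Field K]
    (hK : ((n + 1 + 1 : ℕ) : Cardinal) ≤ Cardinal.mk K)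
    {S : AffineSubspace K (Matrix (Fin (n + 1)) (Fin (n + 1)) K)}
    (hS : IsNilpotentCorankOneAffine S) : finrank K S.direction ≤ n * (n - 1) / 2 := by
  obtain ⟨⟨P, hP⟩, h⟩ := hS
  set f := (Matrix.toLinAlgEquiv' (R := K) (n := Fin (n + 1))) with hf
  have hmem : ∀ B ∈ S.direction, P + B ∈ S := fun B hB => by
    rw [add_comm P B]
    exact AffineSubspace.vadd_mem_of_mem_direction hB hP
  rw [← LinearEquiv.finrank_map_eq f.toLinearEquiv S.direction]
  refine finrank_le_of_affine_nilindex n hK (by simp) (f P) _ ?_ ?_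
  · rintro _ ⟨B, hB, rfl⟩
    have := (isNilpotent_toLin'_iff _).mpr (h _ (hmem B hB)).1
    rw [map_add] at this
    exact this
  · rintro _ ⟨B, hB, rfl⟩ h0
    obtain ⟨h1, h2⟩ := h _ (hmem B hB)
    refine (rank_eq_iff_pow_ne_zero h1).mp h2 (f.injective ?_)
    rw [map_zero, map_pow, map_add]
    exact h0

/-! ### The extremal example `J + N` and its dimension. -/

/-- Each factor moves the lowest nonzero diagonal, made of ones, one step up. In size `n + 1` the
`n`-th power thus keeps a one in the top right corner, and the next power is zero. -/
theorem shift_add_pow_apply {n : ℕ} {K : Type*} [Field K] {B : Matrix (Fin n) (Fin n) K}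
    (hB : B ∈ strictUpperZeroSuperdiagonal n K) (k : ℕ) (i j : Fin n) :
    ((j : ℕ) < i + k → ((superdiagonalShift n K + B) ^ k) i j = 0) ∧
      ((j : ℕ) = i + k → ((superdiagonalShift n K + B) ^ k) i j = 1) := by
  have hlow : ∀ i j : Fin n, (j : ℕ) < i + 1 → (superdiagonalShift n K + B) i j = 0 := by
    intro i j hij
    rw [Matrix.add_apply, hB i j (by omega), superdiagonalShift, Matrix.of_apply,
      if_neg (by omega), add_zero]
  have hsup : ∀ i j : Fin n, (j : ℕ) = i + 1 → (superdiagonalShift n K + B) i j = 1 := by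
    intro i j hij
    rw [Matrix.add_apply, hB i j (by omega), superdiagonalShift, Matrix.of_apply,
      if_pos (by omega), add_zero]
  induction k generalizing i with
  | zero =>
    constructor
    · intro h
      rw [pow_zero, Matrix.one_apply_ne]
      rintro rfl
      omega
    · intro h
      rw [pow_zero, show j = i from Fin.ext h, Matrix.one_apply_eq]
  | succ k ih =>
    rw [pow_succ', Matrix.mul_apply]
    constructor
    · intro h
      refine Finset.sum_eq_zero fun l _ => ?_
      by_cases hl : (l : ℕ) < i + 1
      · rw [hlow i l hl, zero_mul]
      · rw [(ih l).1 (by omega), mul_zero]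
    · intro h
      rw [Finset.sum_eq_single (⟨i + 1, by omega⟩ : Fin n)]
      · rw [hsup _ _ rfl, (ih _).2 (by simp only; omega), mul_one]
      · intro l _ hl
        have hl' : (l : ℕ) ≠ i + 1 := fun h' => hl (Fin.ext h')
        by_cases hl : (l : ℕ) < i + 1
        · rw [hlow i l hl, zero_mul]
        · rw [(ih l).1 (by omega), mul_zero]
      · intro h'
        exact absurd (Finset.mem_univ _) h'

theorem isNilpotentCorankOneAffine_shift (n : ℕ) (K : Type*) [Field K] :
    IsNilpotentCorankOneAffine (AffineSubspace.mk' (superdiagonalShift (n + 1) K)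
      (strictUpperZeroSuperdiagonal (n + 1) K)) := by
  refine ⟨AffineSubspace.mk'_nonempty _ _, fun A hA => ?_⟩
  rw [AffineSubspace.mem_mk', vsub_eq_sub] at hA
  have hpow := fun k i j => shift_add_pow_apply hA k i j
  rw [add_sub_cancel] at hpow
  have hnil : IsNilpotent A := ⟨n + 1, by
    ext i j
    exact (hpow (n + 1) i j).1 (by omega)⟩
  refine ⟨hnil, (rank_eq_iff_pow_ne_zero hnil).mpr fun h0 => ?_⟩
  have := (hpow n 0 (Fin.last n)).2 (by simp)
  rw [h0] at this
  exact zero_ne_one this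

/-- A matrix in `strictUpperZeroSuperdiagonal` is determined by its entries strictly above the
superdiagonal, which are arbitrary. -/
def strictUpperZeroSuperdiagonalEquiv (n : ℕ) (K : Type*) [Field K] :
    strictUpperZeroSuperdiagonal n K ≃ₗ[K]
      ({p : Fin n × Fin n // (p.1 : ℕ) + 1 < p.2} → K) where
  toFun B p := B.1 p.1.1 p.1.2
  map_add' _ _ := rfl
  map_smul' _ _ := rfl
  invFun f := ⟨Matrix.of fun i j => if h : (i : ℕ) + 1 < j then f ⟨(i, j), h⟩ else 0,
    fun i j hij => by simp [Nat.not_lt.mpr hij]⟩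
  left_inv B := by
    refine Subtype.ext (Matrix.ext fun i j => ?_)
    by_cases h : (i : ℕ) + 1 < j
    · simp [h]
    · simp [h, B.2 i j (by omega)]
  right_inv f := by
    ext ⟨⟨i, j⟩, h⟩
    have h' : (i : ℕ) + 1 < j := h
    simp [h']

theorem card_above_superdiagonal (n : ℕ) :
    Fintype.card {p : Fin n × Fin n // (p.1 : ℕ) + 1 < p.2} = (n - 1) * (n - 2) / 2 := by
  rw [Fintype.card_subtype]
  have hfib : ∀ j : Fin n, (Finset.univ.filter fun i : Fin n => (i : ℕ) + 1 < j).card = j - 1 := by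
    intro j
    have : (Finset.univ.filter fun i : Fin n => (i : ℕ) + 1 < j).map Fin.valEmbedding =
        Finset.range (j - 1) := by
      ext a
      simp only [Finset.mem_map, Finset.mem_filter, Finset.mem_univ, true_and,
        Fin.valEmbedding_apply, Finset.mem_range]
      constructor
      · rintro ⟨i, hi, rfl⟩
        omega
      · intro ha
        exact ⟨⟨a, by omega⟩, by simp only; omega, rfl⟩
    rw [← Finset.card_map, this, Finset.card_range]
  have h1 : (Finset.univ.filter fun p : Fin n × Fin n => (p.1 : ℕ) + 1 < p.2).card =
      ∑ j : Fin n, ((j : ℕ) - 1) := by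
    rw [Finset.card_filter, Fintype.sum_prod_type_right]
    refine Finset.sum_congr rfl fun j _ => ?_
    rw [← hfib j, Finset.card_filter]
  -- Column `j` contributes `j - 1` entries; truncated subtraction gives the correct count `0` for
  -- `j = 0`.
  rw [h1, Fin.sum_univ_eq_sum_range (fun j => j - 1)]
  rcases n with _ | n
  · rfl
  · rw [Finset.sum_range_succ']
    simp [Finset.sum_range_id]

theorem finrank_strictUpperZeroSuperdiagonal (n : ℕ) (K : Type*) [Field K] :
    finrank K (strictUpperZeroSuperdiagonal n K) = (n - 1) * (n - 2) / 2 := by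
  rw [(strictUpperZeroSuperdiagonalEquiv n K).finrank_eq, finrank_fintype_fun_eq_card,
    card_above_superdiagonal]

theorem theorem1p4 (n : ℕ) (hn : 1 ≤ n) (K : Type*) [Field K]
    (hK : ((n + 1 : ℕ) : Cardinal) ≤ Cardinal.mk K) :
    -- the maximal dimension
    IsGreatest
      {d : ℕ | ∃ S : AffineSubspace K (Matrix (Fin n) (Fin n) K),
        IsNilpotentCorankOneAffine S ∧ Module.finrank K S.direction = d}
      ((n - 1) * (n - 2) / 2) ∧
    -- for nilpotent matrices, rank `n - 1` means nilindex `n`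
    (∀ A : Matrix (Fin n) (Fin n) K, IsNilpotent A →
      (A.rank = n - 1 ↔ nilpotencyClass A = n)) ∧
    -- an explicit affine subspace attaining the maximum
    (IsNilpotentCorankOneAffine
        (AffineSubspace.mk' (superdiagonalShift n K) (strictUpperZeroSuperdiagonal n K)) ∧
      Module.finrank K
        (AffineSubspace.mk' (superdiagonalShift n K)
          (strictUpperZeroSuperdiagonal n K)).direction = (n - 1) * (n - 2) / 2) := by
  obtain ⟨n, rfl⟩ := Nat.exists_eq_add_of_le' hn
  have hdim : Module.finrank K (AffineSubspace.mk' (superdiagonalShift (n + 1) K)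
      (strictUpperZeroSuperdiagonal (n + 1) K)).direction =
      (n + 1 - 1) * (n + 1 - 2) / 2 := by
    rw [AffineSubspace.direction_mk', finrank_strictUpperZeroSuperdiagonal]
  have hshift := isNilpotentCorankOneAffine_shift n K
  refine ⟨⟨⟨_, hshift, hdim⟩, ?_⟩, fun A hA => rank_eq_iff_nilpotencyClass_eq hA, hshift, hdim⟩
  rintro _ ⟨S, hS, rfl⟩
  exact finrank_direction_le hK hS
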